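/- **Theorem (Robust Relational Hyperproperty Preservation).** For every interface $I$ and every syntactically well-typed target context $C^T$ for $I$ there is a source context $C^S$ for $I$, namely the back-translation $C^S=C^T{\uparrow}$, such that for every partial source program $P$ with interface $I$ and every behaviour $t=(lt,r)$, consisting of a local trace $lt$ that is well formed from the empty history and a Boolean $r$, $$C^T[P{\downarrow}]\leadsto_T t\quad\Longleftrightarrow\quad C^S[P]\leadsto_S t .$$ The notions are as follows. *Events.* The operations are: open a file (a string), read from a file descriptor, write a string to a file descriptor, close a file descriptor (descriptors are natural numbers). Each operation returns either a result (respectively: a descriptor, a string, unit, unit) or an error (a string). An event records an operation with its arguments and its result. A history is the list of past events; $\mathrm{fresh}(h)$ is a descriptor larger than all those returned by openings in $h$. A local trace is well formed from $h$ if each successful opening in it returns the fresh descriptor of the history at that point. *Source.* Computations are elements of the free monad $\mathsf{io}$ on the four operations. A computation $m:\mathsf{io}\,A$ is interpreted as a monotone predicate transformer $\theta(m)$, which maps a history $h$ and a postcondition on local traces and results to a precondition; in it an opening may return $\mathrm{fresh}(h)$, a reading any string, a writing or closing unit, and every operation may fail with the fixed error $\mathtt{err}$. Write $m\Downarrow_h(lt,r)$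 if $p(lt,r)$ holds for every $p$ with $\theta(m)(h)(p)$; then $m\leadsto_S(lt,r)$ means $m\Downarrow_{[]}(lt,r)$. The quotable types are generated from unit, Booleans, strings and file descriptors by $A\to B$, $A\to\mathsf{io}\,B$, $A\times B$ and $A+B$. A typing relation, given by two mutually inductive families of derivations (for values and for $\mathsf{io}$-computations, both as functions of an evaluation environment), has rules for constants, variables, pure and effectful abstraction and application, conditionals, pairs, projections, injections, case analysis, monadic return and bind, and the four operations. An interface is a quotable type $c$. A source context is any element of $c$. A partial source program is a function $P:c\to\mathsf{io}\,\mathsf{bool}$ with a closed typing derivation for it. Linking $C^S[P]$ is the application $P(C^S)$. *Target.* The target is a call-by-value $\lambda$-calculus with unit, Booleans, strings, file descriptors, pairs, sums and the four operations, with a left-to-right small-step semantics in which a step from a history $h$ produces at most one event; operations have the same possible results as in the source. For a closed expression $e$, $e\leadsto_T(lt,r)$ means that $e$ reduces, from the empty history and producing exactly the events $lt$, to the (irreducible) Boolean constant $r$. Target expressions are typed with the quotable types, in a simple type system that distinguishes pure expressions (bodies of functions of type $A\to B$) from effectful ones (bodies of functions of type $A\to\mathsf{io}\,B$). A target context is a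 value with a closed typing derivation at type $c$. A target program is an untyped closed expression, and linking is syntactic application. *Translations.* $P{\downarrow}$ is defined by recursion on the typing derivation of $P$, mapping each rule to the corresponding target construct (and bind to a let-binding, i.e. an applied abstraction). $C^T{\uparrow}$ is defined by recursion on the typing derivation of $C^T$, mapping each rule to the corresponding source function, with effectful expressions interpreted in $\mathsf{io}$ and sequenced left to right. -/

import Mathlib

/-!
A shallowly embedded source language of terminating computations with file operations, carved out of
ordinary functions by a typing relation, a deeply embedded call-by-value target calculus with the
same operations, trace semantics for both, compilation, and back-translation of typed contexts.
-/

namespace SEIO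

/-! ### Operations, events and traces -/

/-- File descriptors are natural numbers. -/
abbrev FileDescr := ℕ

/-- Errors are strings. -/
abbrev Err := String

/-- The result of an operation that may fail. -/
abbrev ResExn (a : Type) := a ⊕ Err

/-- The three-letter string `err`, the only error that operations return. -/
def errMsg : Err := String.ofList [Char.ofNat 101, Char.ofNat 114, Char.ofNat 114]

/-- Events record the arguments and the result of an operation. -/
inductive Event : Type
  | read : FileDescr → ResExn String → Event
  | write : FileDescr → String → ResExn Unit → Event
  | openFile : String → ResExn FileDescr → Event
  | close : FileDescr → ResExn Unit → Event

abbrev Trace := List Event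

/-- Past events, the most recent one first. -/
abbrev History := List Event

/-- `h ++ lt`: the history after the local trace `lt` (in chronological order) has happened. -/
def History.app (h : History) (lt : Trace) : History := lt.reverse ++ h

/-- A file descriptor larger than all those that were generated in the history. -/
def freshFd : History → FileDescr
  | [] => 0
  | .openFile _ (.inl fd) :: h => max (fd + 1) (freshFd h)
  | _ :: h => freshFd h

/-- A successful opening must return the fresh descriptor of the current history. -/
def WfEvent (h : History) : Event → Prop
  | .openFile _ (.inl fd) => fd = freshFd h
  | _ => True

def WfLocalTrace : History → Trace → Prop
  | _, [] => True
  | h, ev :: lt => WfEvent h ev ∧ WfLocalTrace (ev :: h) lt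

/-- Local traces that are well formed with respect to the history from which they start. -/
abbrev LocalTrace (h : History) := {lt : Trace // WfLocalTrace h lt}

def LocalTrace.nil (h : History) : LocalTrace h := ⟨[], trivial⟩

theorem wfLocalTrace_append : ∀ (lt : Trace) (h : History) (lt' : Trace),
    WfLocalTrace h lt → WfLocalTrace (h.app lt) lt' → WfLocalTrace h (lt ++ lt')
  | [], _, _, _, h2 => by simpa [History.app] using h2
  | ev :: lt, h, lt', h1, h2 =>
    ⟨h1.1, wfLocalTrace_append lt (ev :: h) lt' h1.2 (by simpa [History.app] using h2)⟩

def LocalTrace.append {h : History} (lt : LocalTrace h) (lt' : LocalTrace (h.app lt.1)) :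
    LocalTrace h :=
  ⟨lt.1 ++ lt'.1, wfLocalTrace_append _ _ _ lt.2 lt'.2⟩

/-! ### The free monad of computations -/

inductive IoOp : Type
  | read | write | openFile | close

def IoArgs : IoOp → Type
  | .read => FileDescr
  | .write => FileDescr × String
  | .openFile => String
  | .close => FileDescr

def IoRes : IoOp → Type
  | .read => ResExn String
  | .write => ResExn Unit
  | .openFile => ResExn FileDescr
  | .close => ResExn Unit

inductive Io (a : Type) : Type
  | ret : a → Io a
  | call : (o : IoOp) → (args : IoArgs o) → (IoRes o → Io a) → Io a

def Io.bind {a b : Type} : Io a → (a → Io b) → Io b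
  | .ret x, k => k x
  | .call o args ok, k => .call o args (fun i => Io.bind (ok i) k)

def ioRead (fd : FileDescr) : Io (ResExn String) := .call .read fd .ret

def ioWrite (fd : FileDescr) (s : String) : Io (ResExn Unit) := .call .write (fd, s) .ret

def ioOpen (s : String) : Io (ResExn FileDescr) := .call .openFile s .ret

def ioClose (fd : FileDescr) : Io (ResExn Unit) := .call .close fd .ret

def opToEv : (o : IoOp) → IoArgs o → IoRes o → Event
  | .read, fd, r => .read fd r
  | .write, args, r => .write args.1 args.2 r
  | .openFile, s, r => .openFile s r
  | .close, fd, r => .close fd r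

/-- The possible results of an operation: an opening that succeeds returns the fresh descriptor, a
successful reading may return any string, and every operation may fail with the fixed error. -/
def IoPost (h : History) : (o : IoOp) → IoArgs o → IoRes o → Prop
  | .read, _, r => ∀ e : Err, r = Sum.inr e → e = errMsg
  | .write, _, r => ∀ e : Err, r = Sum.inr e → e = errMsg
  | .openFile, _, r =>
      (∀ fd : FileDescr, r = Sum.inl fd → fd = freshFd h) ∧ ∀ e : Err, r = Sum.inr e → e = errMsg
  | .close, _, r => ∀ e : Err, r = Sum.inr e → e = errMsg

/-! ### Predicate transformer semantics of computations -/

abbrev HistPost (h : History) (a : Type) := LocalTrace h → a → Prop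

abbrev Hist0 (a : Type) := (h : History) → HistPost h a → Prop

def HistPost.Le {h : History} {a : Type} (p1 p2 : HistPost h a) : Prop := ∀ lt r, p1 lt r → p2 lt r

def HistMonotonic {a : Type} (wp : Hist0 a) : Prop :=
  ∀ h (p1 p2 : HistPost h a), p1.Le p2 → wp h p1 → wp h p2

/-- Monotonic predicate transformers. -/
abbrev Hist (a : Type) := {wp : Hist0 a // HistMonotonic wp}

def histReturn {a : Type} (x : a) : Hist a :=
  ⟨fun h p => p (LocalTrace.nil h) x, fun _ _ _ hp hx => hp _ _ hx⟩

def postShift {a : Type} (h : History) (p : HistPost h a) (lt : LocalTrace h) :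
    HistPost (h.app lt.1) a :=
  fun lt' r => p (lt.append lt') r

def histPostBind {a b : Type} {h : History} (kw : a → Hist b) (p : HistPost h b) : HistPost h a :=
  fun lt r => (kw r).1 (h.app lt.1) (postShift h p lt)

def histBind {a b : Type} (w : Hist a) (kw : a → Hist b) : Hist b :=
  ⟨fun h p => w.1 h (histPostBind kw p), fun h _ _ hp hw =>
    w.2 h _ _ (fun _ r hk => (kw r).2 _ _ _ (fun _ _ hq => hp _ _ hq) hk) hw⟩

def opWp (o : IoOp) (args : IoArgs o) : Hist (IoRes o) :=
  ⟨fun h p => ∀ (lt : LocalTrace h) (r : IoRes o),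
      IoPost h o args r ∧ lt.1 = [opToEv o args r] → p lt r,
    fun _ _ _ hp hw _ _ hr => hp _ _ (hw _ _ hr)⟩

/-- The weakest precondition of a computation. -/
def theta {a : Type} : Io a → Hist a
  | .ret x => histReturn x
  | .call o args k => histBind (opWp o args) (fun r => theta (k r))

/-- Source behaviour: the strongest postcondition that corresponds to `theta m`. -/
def FsBeh {a : Type} (m : Io a) (h : History) : HistPost h a :=
  fun lt r => ∀ p : HistPost h a, (theta m).1 h p → p lt r

/-! ### Quotable types -/

/-- The types that can be quoted. -/
inductive TypeRep : Type → Type 1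
  | unit : TypeRep Unit
  | bool : TypeRep Bool
  | fileDescr : TypeRep FileDescr
  | string : TypeRep String
  | arr : {a b : Type} → TypeRep a → TypeRep b → TypeRep (a → b)
  | arrIo : {a b : Type} → TypeRep a → TypeRep b → TypeRep (a → Io b)
  | pair : {a b : Type} → TypeRep a → TypeRep b → TypeRep (a × b)
  | sum : {a b : Type} → TypeRep a → TypeRep b → TypeRep (a ⊕ b)

/-- A type together with a proof that it can be quoted. -/
abbrev QType := Σ a : Type, TypeRep a

abbrev qUnit : QType := ⟨Unit, .unit⟩
abbrev qBool : QType := ⟨Bool, .bool⟩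
abbrev qFileDescr : QType := ⟨FileDescr, .fileDescr⟩
abbrev qString : QType := ⟨String, .string⟩
abbrev qArr (a b : QType) : QType := ⟨a.1 → b.1, .arr a.2 b.2⟩
abbrev qArrIo (a b : QType) : QType := ⟨a.1 → Io b.1, .arrIo a.2 b.2⟩
abbrev qPair (a b : QType) : QType := ⟨a.1 × b.1, .pair a.2 b.2⟩
abbrev qSum (a b : QType) : QType := ⟨a.1 ⊕ b.1, .sum a.2 b.2⟩
abbrev qResExn (a : QType) : QType := qSum a qString

/-- Typing environments: the type of the de Bruijn variable `n` is the entry at position `n`. -/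
abbrev TypEnv := List QType

/-- Evaluation environments: stacks with one value for each entry of the typing environment. -/
def EvalEnv : TypEnv → Type
  | [] => Unit
  | a :: G => a.1 × EvalEnv G

def EvalEnv.push {G : TypEnv} {a : QType} (g : EvalEnv G) (x : a.1) : EvalEnv (a :: G) := (x, g)

def EvalEnv.hd {G : TypEnv} {a : QType} (g : EvalEnv (a :: G)) : a.1 := Prod.fst g

def EvalEnv.tail {G : TypEnv} {a : QType} (g : EvalEnv (a :: G)) : EvalEnv G := Prod.snd g

def EvalEnv.lookup : {G : TypEnv} → EvalEnv G → (n : ℕ) → {a : QType} → G[n]? = some a → a.1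
  | [], _, _, _, h => by simp at h
  | _ :: _, g, 0, _, h => (Option.some.inj h) ▸ g.hd
  | _ :: _, g, n + 1, _, h => EvalEnv.lookup g.tail n (by simpa using h)

/-! ### The source language: typing derivations of open values and of open computations -/

mutual

/-- Derivations for open values: functions from evaluation environments to values. -/
inductive TypingOVal : (G : TypEnv) → (a : QType) → (EvalEnv G → a.1) → Type 1
  | qtt : {G : TypEnv} → TypingOVal G qUnit (fun _ => ())
  | qtrue : {G : TypEnv} → TypingOVal G qBool (fun _ => true)
  | qfalse : {G : TypEnv} → TypingOVal G qBool (fun _ => false)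
  | qstringLit : {G : TypEnv} → (s : String) → TypingOVal G qString (fun _ => s)
  | qvar0 : {G : TypEnv} → {a : QType} → TypingOVal (a :: G) a (fun g => g.hd)
  | qvarS : {G : TypEnv} → {a b : QType} → {x : EvalEnv G → a.1} →
      TypingOVal G a x → TypingOVal (b :: G) a (fun g => x g.tail)
  | qapp : {G : TypEnv} → {a b : QType} → {f : EvalEnv G → a.1 → b.1} → {x : EvalEnv G → a.1} →
      TypingOVal G (qArr a b) f → TypingOVal G a x → TypingOVal G b (fun g => (f g) (x g))
  | qlambda : {G : TypEnv} → {a b : QType} → {body : EvalEnv (a :: G) → b.1} →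
      TypingOVal (a :: G) b body → TypingOVal G (qArr a b) (fun g x => body (g.push x))
  | qlambdaIo : {G : TypEnv} → {a b : QType} → {body : EvalEnv (a :: G) → Io b.1} →
      TypingOProd (a :: G) b body → TypingOVal G (qArrIo a b) (fun g x => body (g.push x))
  | qif : {G : TypEnv} → {a : QType} → {c : EvalEnv G → Bool} → {t e : EvalEnv G → a.1} →
      TypingOVal G qBool c → TypingOVal G a t → TypingOVal G a e →
      TypingOVal G a (fun g => cond (c g) (t g) (e g))
  | qmkpair : {G : TypEnv} → {a b : QType} → {x : EvalEnv G → a.1} → {y : EvalEnv G → b.1} →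
      TypingOVal G a x → TypingOVal G b y → TypingOVal G (qPair a b) (fun g => (x g, y g))
  | qfst : {G : TypEnv} → {a b : QType} → {x : EvalEnv G → a.1 × b.1} →
      TypingOVal G (qPair a b) x → TypingOVal G a (fun g => (x g).1)
  | qsnd : {G : TypEnv} → {a b : QType} → {x : EvalEnv G → a.1 × b.1} →
      TypingOVal G (qPair a b) x → TypingOVal G b (fun g => (x g).2)
  | qinl : {G : TypEnv} → {a b : QType} → {x : EvalEnv G → a.1} →
      TypingOVal G a x → TypingOVal G (qSum a b) (fun g => Sum.inl (x g))
  | qinr : {G : TypEnv} → {a b : QType} → {x : EvalEnv G → b.1} →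
      TypingOVal G b x → TypingOVal G (qSum a b) (fun g => Sum.inr (x g))
  | qcase : {G : TypEnv} → {a b c : QType} → {sc : EvalEnv G → a.1 ⊕ b.1} →
      {il : EvalEnv (a :: G) → c.1} → {ir : EvalEnv (b :: G) → c.1} →
      TypingOVal G (qSum a b) sc → TypingOVal (a :: G) c il → TypingOVal (b :: G) c ir →
      TypingOVal G c (fun g => Sum.elim (fun x => il (g.push x)) (fun y => ir (g.push y)) (sc g))

/-- Derivations for open computations. -/
inductive TypingOProd : (G : TypEnv) → (a : QType) → (EvalEnv G → Io a.1) → Type 1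
  | qreturn : {G : TypEnv} → {a : QType} → {x : EvalEnv G → a.1} →
      TypingOVal G a x → TypingOProd G a (fun g => Io.ret (x g))
  | qbind : {G : TypEnv} → {a b : QType} → {m : EvalEnv G → Io a.1} →
      {k : EvalEnv (a :: G) → Io b.1} →
      TypingOProd G a m → TypingOProd (a :: G) b k →
      TypingOProd G b (fun g => Io.bind (m g) (fun x => k (g.push x)))
  | qappIo : {G : TypEnv} → {a b : QType} → {f : EvalEnv G → a.1 → Io b.1} →
      {x : EvalEnv G → a.1} →
      TypingOVal G (qArrIo a b) f → TypingOVal G a x → TypingOProd G b (fun g => (f g) (x g))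
  | qifIo : {G : TypEnv} → {a : QType} → {c : EvalEnv G → Bool} → {t e : EvalEnv G → Io a.1} →
      TypingOVal G qBool c → TypingOProd G a t → TypingOProd G a e →
      TypingOProd G a (fun g => cond (c g) (t g) (e g))
  | qcaseIo : {G : TypEnv} → {a b c : QType} → {sc : EvalEnv G → a.1 ⊕ b.1} →
      {il : EvalEnv (a :: G) → Io c.1} → {ir : EvalEnv (b :: G) → Io c.1} →
      TypingOVal G (qSum a b) sc → TypingOProd (a :: G) c il → TypingOProd (b :: G) c ir →
      TypingOProd G c (fun g => Sum.elim (fun x => il (g.push x)) (fun y => ir (g.push y)) (sc g))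
  | qread : {G : TypEnv} → {fd : EvalEnv G → FileDescr} →
      TypingOVal G qFileDescr fd → TypingOProd G (qResExn qString) (fun g => ioRead (fd g))
  | qwrite : {G : TypEnv} → {fd : EvalEnv G → FileDescr} → {s : EvalEnv G → String} →
      TypingOVal G qFileDescr fd → TypingOVal G qString s →
      TypingOProd G (qResExn qUnit) (fun g => ioWrite (fd g) (s g))
  | qopenfile : {G : TypEnv} → {s : EvalEnv G → String} →
      TypingOVal G qString s → TypingOProd G (qResExn qFileDescr) (fun g => ioOpen (s g))
  | qclose : {G : TypEnv} → {fd : EvalEnv G → FileDescr} →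
      TypingOVal G qFileDescr fd → TypingOProd G (qResExn qUnit) (fun g => ioClose (fd g))

end

/-! ### The target calculus -/

/-- Expressions, with de Bruijn indices; `lam` and both branches of `case` bind one variable. -/
inductive Exp : Type
  | var : ℕ → Exp
  | unit : Exp
  | tru : Exp
  | fls : Exp
  | fileDescr : FileDescr → Exp
  | string : String → Exp
  | lam : Exp → Exp
  | app : Exp → Exp → Exp
  | ite : Exp → Exp → Exp → Exp
  | pair : Exp → Exp → Exp
  | fst : Exp → Exp
  | snd : Exp → Exp
  | inl : Exp → Exp
  | inr : Exp → Exp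
  | case : Exp → Exp → Exp → Exp
  | read : Exp → Exp
  | write : Exp → Exp → Exp
  | openFile : Exp → Exp
  | close : Exp → Exp

/-- All free variables are smaller than `n`. -/
def Exp.ClosedAt : ℕ → Exp → Prop
  | n, .var x => x < n
  | _, .unit => True
  | _, .tru => True
  | _, .fls => True
  | _, .fileDescr _ => True
  | _, .string _ => True
  | n, .lam e => e.ClosedAt (n + 1)
  | n, .app e1 e2 => e1.ClosedAt n ∧ e2.ClosedAt n
  | n, .ite e1 e2 e3 => e1.ClosedAt n ∧ e2.ClosedAt n ∧ e3.ClosedAt n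
  | n, .pair e1 e2 => e1.ClosedAt n ∧ e2.ClosedAt n
  | n, .fst e => e.ClosedAt n
  | n, .snd e => e.ClosedAt n
  | n, .inl e => e.ClosedAt n
  | n, .inr e => e.ClosedAt n
  | n, .case e1 e2 e3 => e1.ClosedAt n ∧ e2.ClosedAt (n + 1) ∧ e3.ClosedAt (n + 1)
  | n, .read e => e.ClosedAt n
  | n, .write e1 e2 => e1.ClosedAt n ∧ e2.ClosedAt n
  | n, .openFile e => e.ClosedAt n
  | n, .close e => e.ClosedAt n

abbrev ClosedExp := {e : Exp // e.ClosedAt 0}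

/-- Values: closed expressions in introduction form. -/
def Exp.IsValue : Exp → Prop
  | .unit => True
  | .tru => True
  | .fls => True
  | .fileDescr _ => True
  | .string _ => True
  | .lam e => e.ClosedAt 1
  | .pair e1 e2 => e1.IsValue ∧ e2.IsValue
  | .inl e => e.IsValue
  | .inr e => e.IsValue
  | _ => False

abbrev Value := {e : Exp // e.IsValue}

theorem Exp.IsValue.closed : ∀ {e : Exp}, e.IsValue → e.ClosedAt 0
  | .unit, _ => trivial
  | .tru, _ => trivial
  | .fls, _ => trivial
  | .fileDescr _, _ => trivial
  | .string _, _ => trivial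
  | .lam _, h => h
  | .pair _ _, h => ⟨Exp.IsValue.closed h.1, Exp.IsValue.closed h.2⟩
  | .inl e, h => Exp.IsValue.closed (e := e) h
  | .inr e, h => Exp.IsValue.closed (e := e) h

/-- Lift a renaming below one binder. -/
def liftRen (r : ℕ → ℕ) : ℕ → ℕ
  | 0 => 0
  | n + 1 => r n + 1

def Exp.rename : (ℕ → ℕ) → Exp → Exp
  | r, .var x => .var (r x)
  | _, .unit => .unit
  | _, .tru => .tru
  | _, .fls => .fls
  | _, .fileDescr fd => .fileDescr fd
  | _, .string s => .string s
  | r, .lam e => .lam (e.rename (liftRen r))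
  | r, .app e1 e2 => .app (e1.rename r) (e2.rename r)
  | r, .ite e1 e2 e3 => .ite (e1.rename r) (e2.rename r) (e3.rename r)
  | r, .pair e1 e2 => .pair (e1.rename r) (e2.rename r)
  | r, .fst e => .fst (e.rename r)
  | r, .snd e => .snd (e.rename r)
  | r, .inl e => .inl (e.rename r)
  | r, .inr e => .inr (e.rename r)
  | r, .case e1 e2 e3 => .case (e1.rename r) (e2.rename (liftRen r)) (e3.rename (liftRen r))
  | r, .read e => .read (e.rename r)
  | r, .write e1 e2 => .write (e1.rename r) (e2.rename r)
  | r, .openFile e => .openFile (e.rename r)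
  | r, .close e => .close (e.rename r)

/-- Lift a parallel substitution below one binder. -/
def liftSub (s : ℕ → Exp) : ℕ → Exp
  | 0 => .var 0
  | n + 1 => (s n).rename Nat.succ

def Exp.subst : (ℕ → Exp) → Exp → Exp
  | s, .var x => s x
  | _, .unit => .unit
  | _, .tru => .tru
  | _, .fls => .fls
  | _, .fileDescr fd => .fileDescr fd
  | _, .string s => .string s
  | s, .lam e => .lam (e.subst (liftSub s))
  | s, .app e1 e2 => .app (e1.subst s) (e2.subst s)
  | s, .ite e1 e2 e3 => .ite (e1.subst s) (e2.subst s) (e3.subst s)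
  | s, .pair e1 e2 => .pair (e1.subst s) (e2.subst s)
  | s, .fst e => .fst (e.subst s)
  | s, .snd e => .snd (e.subst s)
  | s, .inl e => .inl (e.subst s)
  | s, .inr e => .inr (e.subst s)
  | s, .case e1 e2 e3 => .case (e1.subst s) (e2.subst (liftSub s)) (e3.subst (liftSub s))
  | s, .read e => .read (e.subst s)
  | s, .write e1 e2 => .write (e1.subst s) (e2.subst s)
  | s, .openFile e => .openFile (e.subst s)
  | s, .close e => .close (e.subst s)

/-- Replace the variable `0` by `v` and decrement the other variables. -/
def substBeta (v e : Exp) : Exp :=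
  e.subst (fun n => Nat.casesOn n v Exp.var)

/-- One step of left-to-right call-by-value reduction from a history, with the event it produces,
if any. Closed expressions only step to closed expressions, and every event that a step produces is
well formed with respect to the history. -/
inductive Step : Exp → Exp → History → Option Event → Prop
  | appLeft {e1 e1' e2 : Exp} {h : History} {oev : Option Event} :
      Step e1 e1' h oev → Step (.app e1 e2) (.app e1' e2) h oev
  | appRight {v e2 e2' : Exp} {h : History} {oev : Option Event} : v.IsValue →
      Step e2 e2' h oev → Step (.app v e2) (.app v e2') h oev
  | beta {e v : Exp} {h : History} : v.IsValue → Step (.app (.lam e) v) (substBeta v e) h none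
  | ite {c c' e1 e2 : Exp} {h : History} {oev : Option Event} :
      Step c c' h oev → Step (.ite c e1 e2) (.ite c' e1 e2) h oev
  | iteTrue {e1 e2 : Exp} {h : History} : Step (.ite .tru e1 e2) e1 h none
  | iteFalse {e1 e2 : Exp} {h : History} : Step (.ite .fls e1 e2) e2 h none
  | pairLeft {e1 e1' e2 : Exp} {h : History} {oev : Option Event} :
      Step e1 e1' h oev → Step (.pair e1 e2) (.pair e1' e2) h oev
  | pairRight {v e2 e2' : Exp} {h : History} {oev : Option Event} : v.IsValue →
      Step e2 e2' h oev → Step (.pair v e2) (.pair v e2') h oev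
  | fst {e e' : Exp} {h : History} {oev : Option Event} :
      Step e e' h oev → Step (.fst e) (.fst e') h oev
  | fstPair {v1 v2 : Exp} {h : History} : v1.IsValue → v2.IsValue →
      Step (.fst (.pair v1 v2)) v1 h none
  | snd {e e' : Exp} {h : History} {oev : Option Event} :
      Step e e' h oev → Step (.snd e) (.snd e') h oev
  | sndPair {v1 v2 : Exp} {h : History} : v1.IsValue → v2.IsValue →
      Step (.snd (.pair v1 v2)) v2 h none
  | inl {e e' : Exp} {h : History} {oev : Option Event} :
      Step e e' h oev → Step (.inl e) (.inl e') h oev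
  | inr {e e' : Exp} {h : History} {oev : Option Event} :
      Step e e' h oev → Step (.inr e) (.inr e') h oev
  | case {e e' e1 e2 : Exp} {h : History} {oev : Option Event} :
      Step e e' h oev → Step (.case e e1 e2) (.case e' e1 e2) h oev
  | caseInl {v e1 e2 : Exp} {h : History} : v.IsValue →
      Step (.case (.inl v) e1 e2) (substBeta v e1) h none
  | caseInr {v e1 e2 : Exp} {h : History} : v.IsValue →
      Step (.case (.inr v) e1 e2) (substBeta v e2) h none
  | read {e e' : Exp} {h : History} {oev : Option Event} :
      Step e e' h oev → Step (.read e) (.read e') h oev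
  | readSuccess (fd : FileDescr) (s : String) (h : History) :
      Step (.read (.fileDescr fd)) (.inl (.string s)) h (some (.read fd (.inl s)))
  | readFail (fd : FileDescr) (h : History) :
      Step (.read (.fileDescr fd)) (.inr (.string errMsg)) h (some (.read fd (.inr errMsg)))
  | writeLeft {e1 e1' e2 : Exp} {h : History} {oev : Option Event} :
      Step e1 e1' h oev → Step (.write e1 e2) (.write e1' e2) h oev
  | writeRight {v e2 e2' : Exp} {h : History} {oev : Option Event} : v.IsValue →
      Step e2 e2' h oev → Step (.write v e2) (.write v e2') h oev
  | writeSuccess (fd : FileDescr) (s : String) (h : History) :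
      Step (.write (.fileDescr fd) (.string s)) (.inl .unit) h (some (.write fd s (.inl ())))
  | writeFail (fd : FileDescr) (s : String) (h : History) :
      Step (.write (.fileDescr fd) (.string s)) (.inr (.string errMsg)) h
        (some (.write fd s (.inr errMsg)))
  | openFile {e e' : Exp} {h : History} {oev : Option Event} :
      Step e e' h oev → Step (.openFile e) (.openFile e') h oev
  | openSuccess (s : String) (h : History) :
      Step (.openFile (.string s)) (.inl (.fileDescr (freshFd h))) h
        (some (.openFile s (.inl (freshFd h))))
  | openFail (s : String) (h : History) :
      Step (.openFile (.string s)) (.inr (.string errMsg)) h (some (.openFile s (.inr errMsg)))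
  | close {e e' : Exp} {h : History} {oev : Option Event} :
      Step e e' h oev → Step (.close e) (.close e') h oev
  | closeSuccess (fd : FileDescr) (h : History) :
      Step (.close (.fileDescr fd)) (.inl .unit) h (some (.close fd (.inl ())))
  | closeFail (fd : FileDescr) (h : History) :
      Step (.close (.fileDescr fd)) (.inr (.string errMsg)) h (some (.close fd (.inr errMsg)))

/-- The reflexive-transitive closure of `Step`, with the local trace of the events produced. -/
inductive Steps : Exp → Exp → History → Trace → Prop
  | refl (e : Exp) (h : History) : Steps e e h []
  | trans {e1 e2 e3 : Exp} {h : History} {oev : Option Event} {lt : Trace} :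
      Step e1 e2 h oev → Steps e2 e3 (h.app oev.toList) lt → Steps e1 e3 h (oev.toList ++ lt)

def Irreducible (e : Exp) (h : History) : Prop := ∀ e' oev, ¬ Step e e' h oev

/-- Target behaviour: `e` reduces to the irreducible expression `e'` with local trace `lt`. -/
def EBeh (e e' : Exp) (h : History) (lt : LocalTrace h) : Prop :=
  Steps e e' h lt.1 ∧ Irreducible e' (h.app lt.1)

/-- Effects: an expression typed at `pure` performs no operation. -/
inductive Eff : Type
  | pure | io

/-- Syntactic typing derivations of the target calculus. Since types distinguish pure functions from
effectful ones, the judgement carries an effect: `Typing .pure G e a` types pure expressions, and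
`Typing .io G e a` arbitrary ones. The body of a function of pure type is pure. -/
inductive Typing : Eff → TypEnv → Exp → QType → Type 1
  | var {ε : Eff} {G : TypEnv} {a : QType} (n : ℕ) : G[n]? = some a → Typing ε G (.var n) a
  | unit {ε : Eff} {G : TypEnv} : Typing ε G .unit qUnit
  | tru {ε : Eff} {G : TypEnv} : Typing ε G .tru qBool
  | fls {ε : Eff} {G : TypEnv} : Typing ε G .fls qBool
  | fileDescr {ε : Eff} {G : TypEnv} (fd : FileDescr) : Typing ε G (.fileDescr fd) qFileDescr
  | string {ε : Eff} {G : TypEnv} (s : String) : Typing ε G (.string s) qString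
  | lam {ε : Eff} {G : TypEnv} {a b : QType} {e : Exp} :
      Typing .pure (a :: G) e b → Typing ε G (.lam e) (qArr a b)
  | lamIo {ε : Eff} {G : TypEnv} {a b : QType} {e : Exp} :
      Typing .io (a :: G) e b → Typing ε G (.lam e) (qArrIo a b)
  | app {ε : Eff} {G : TypEnv} {a b : QType} {e1 e2 : Exp} :
      Typing ε G e1 (qArr a b) → Typing ε G e2 a → Typing ε G (.app e1 e2) b
  | appIo {G : TypEnv} {a b : QType} {e1 e2 : Exp} :
      Typing .io G e1 (qArrIo a b) → Typing .io G e2 a → Typing .io G (.app e1 e2) b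
  | ite {ε : Eff} {G : TypEnv} {a : QType} {e1 e2 e3 : Exp} :
      Typing ε G e1 qBool → Typing ε G e2 a → Typing ε G e3 a → Typing ε G (.ite e1 e2 e3) a
  | pair {ε : Eff} {G : TypEnv} {a b : QType} {e1 e2 : Exp} :
      Typing ε G e1 a → Typing ε G e2 b → Typing ε G (.pair e1 e2) (qPair a b)
  | fst {ε : Eff} {G : TypEnv} {a b : QType} {e : Exp} :
      Typing ε G e (qPair a b) → Typing ε G (.fst e) a
  | snd {ε : Eff} {G : TypEnv} {a b : QType} {e : Exp} :
      Typing ε G e (qPair a b) → Typing ε G (.snd e) b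
  | inl {ε : Eff} {G : TypEnv} {a b : QType} {e : Exp} :
      Typing ε G e a → Typing ε G (.inl e) (qSum a b)
  | inr {ε : Eff} {G : TypEnv} {a b : QType} {e : Exp} :
      Typing ε G e b → Typing ε G (.inr e) (qSum a b)
  | case {ε : Eff} {G : TypEnv} {a b c : QType} {e1 e2 e3 : Exp} :
      Typing ε G e1 (qSum a b) → Typing ε (a :: G) e2 c → Typing ε (b :: G) e3 c →
      Typing ε G (.case e1 e2 e3) c
  | read {G : TypEnv} {e : Exp} :
      Typing .io G e qFileDescr → Typing .io G (.read e) (qResExn qString)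
  | write {G : TypEnv} {e1 e2 : Exp} :
      Typing .io G e1 qFileDescr → Typing .io G e2 qString →
      Typing .io G (.write e1 e2) (qResExn qUnit)
  | openFile {G : TypEnv} {e : Exp} :
      Typing .io G e qString → Typing .io G (.openFile e) (qResExn qFileDescr)
  | close {G : TypEnv} {e : Exp} :
      Typing .io G e qFileDescr → Typing .io G (.close e) (qResExn qUnit)

/-! ### Compilation: generation of target syntax from source derivations -/

mutual

def compileVal : {G : TypEnv} → {a : QType} → {x : EvalEnv G → a.1} → TypingOVal G a x → Exp
  | _, _, _, .qtt => .unit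
  | _, _, _, .qtrue => .tru
  | _, _, _, .qfalse => .fls
  | _, _, _, .qstringLit s => .string s
  | _, _, _, .qvar0 => .var 0
  | _, _, _, .qvarS d => (compileVal d).rename Nat.succ
  | _, _, _, .qapp d1 d2 => .app (compileVal d1) (compileVal d2)
  | _, _, _, .qlambda d => .lam (compileVal d)
  | _, _, _, .qlambdaIo d => .lam (compileProd d)
  | _, _, _, .qif d1 d2 d3 => .ite (compileVal d1) (compileVal d2) (compileVal d3)
  | _, _, _, .qmkpair d1 d2 => .pair (compileVal d1) (compileVal d2)
  | _, _, _, .qfst d => .fst (compileVal d)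
  | _, _, _, .qsnd d => .snd (compileVal d)
  | _, _, _, .qinl d => .inl (compileVal d)
  | _, _, _, .qinr d => .inr (compileVal d)
  | _, _, _, .qcase d1 d2 d3 => .case (compileVal d1) (compileVal d2) (compileVal d3)

def compileProd : {G : TypEnv} → {a : QType} → {m : EvalEnv G → Io a.1} → TypingOProd G a m → Exp
  | _, _, _, .qreturn d => compileVal d
  | _, _, _, .qbind d1 d2 => .app (.lam (compileProd d2)) (compileProd d1)
  | _, _, _, .qappIo d1 d2 => .app (compileVal d1) (compileVal d2)
  | _, _, _, .qifIo d1 d2 d3 => .ite (compileVal d1) (compileProd d2) (compileProd d3)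
  | _, _, _, .qcaseIo d1 d2 d3 => .case (compileVal d1) (compileProd d2) (compileProd d3)
  | _, _, _, .qread d => .read (compileVal d)
  | _, _, _, .qwrite d1 d2 => .write (compileVal d1) (compileVal d2)
  | _, _, _, .qopenfile d => .openFile (compileVal d)
  | _, _, _, .qclose d => .close (compileVal d)

end

theorem Exp.ClosedAt.rename : ∀ (e : Exp) {n m : ℕ} {r : ℕ → ℕ}, (∀ x, x < n → r x < m) →
    e.ClosedAt n → (e.rename r).ClosedAt m := by
  have lift : ∀ {n m : ℕ} {r : ℕ → ℕ}, (∀ x, x < n → r x < m) →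
      ∀ x, x < n + 1 → liftRen r x < m + 1 := by
    intro n m r hr x hx
    cases x with
    | zero => simp [liftRen]
    | succ x => simpa [liftRen] using hr x (by omega)
  intro e
  induction e with
  | var x => intro n m r hr h; exact hr x h
  | unit | tru | fls | fileDescr | string => intros; trivial
  | lam e ih => intro n m r hr h; exact ih (lift hr) h
  | app _ _ ih1 ih2 | pair _ _ ih1 ih2 | write _ _ ih1 ih2 =>
    intro n m r hr h; exact ⟨ih1 hr h.1, ih2 hr h.2⟩
  | ite _ _ _ ih1 ih2 ih3 => intro n m r hr h; exact ⟨ih1 hr h.1, ih2 hr h.2.1, ih3 hr h.2.2⟩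
  | case _ _ _ ih1 ih2 ih3 =>
    intro n m r hr h; exact ⟨ih1 hr h.1, ih2 (lift hr) h.2.1, ih3 (lift hr) h.2.2⟩
  | fst _ ih | snd _ ih | inl _ ih | inr _ ih | read _ ih | openFile _ ih | close _ ih =>
    intro n m r hr h; exact ih hr h

mutual

theorem compileVal_closed : {G : TypEnv} → {a : QType} → {x : EvalEnv G → a.1} →
    (d : TypingOVal G a x) → (compileVal d).ClosedAt G.length
  | _, _, _, .qtt => trivial
  | _, _, _, .qtrue => trivial
  | _, _, _, .qfalse => trivial
  | _, _, _, .qstringLit _ => trivial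
  | _, _, _, .qvar0 => Nat.succ_pos _
  | _, _, _, .qvarS d => (compileVal_closed d).rename _ (fun _ hx => Nat.succ_lt_succ hx)
  | _, _, _, .qapp d1 d2 => ⟨compileVal_closed d1, compileVal_closed d2⟩
  | _, _, _, .qlambda d => compileVal_closed d
  | _, _, _, .qlambdaIo d => compileProd_closed d
  | _, _, _, .qif d1 d2 d3 => ⟨compileVal_closed d1, compileVal_closed d2, compileVal_closed d3⟩
  | _, _, _, .qmkpair d1 d2 => ⟨compileVal_closed d1, compileVal_closed d2⟩
  | _, _, _, .qfst d => compileVal_closed d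
  | _, _, _, .qsnd d => compileVal_closed d
  | _, _, _, .qinl d => compileVal_closed d
  | _, _, _, .qinr d => compileVal_closed d
  | _, _, _, .qcase d1 d2 d3 => ⟨compileVal_closed d1, compileVal_closed d2, compileVal_closed d3⟩

theorem compileProd_closed : {G : TypEnv} → {a : QType} → {m : EvalEnv G → Io a.1} →
    (d : TypingOProd G a m) → (compileProd d).ClosedAt G.length
  | _, _, _, .qreturn d => compileVal_closed d
  | _, _, _, .qbind d1 d2 => ⟨compileProd_closed d2, compileProd_closed d1⟩
  | _, _, _, .qappIo d1 d2 => ⟨compileVal_closed d1, compileVal_closed d2⟩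
  | _, _, _, .qifIo d1 d2 d3 =>
    ⟨compileVal_closed d1, compileProd_closed d2, compileProd_closed d3⟩
  | _, _, _, .qcaseIo d1 d2 d3 =>
    ⟨compileVal_closed d1, compileProd_closed d2, compileProd_closed d3⟩
  | _, _, _, .qread d => compileVal_closed d
  | _, _, _, .qwrite d1 d2 => ⟨compileVal_closed d1, compileVal_closed d2⟩
  | _, _, _, .qopenfile d => compileVal_closed d
  | _, _, _, .qclose d => compileVal_closed d

end

/-! ### Back-translation: from target typing derivations to source values and computations -/

/-- The source type of expressions of type `a` and effect `ε`. -/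
def Eff.M : Eff → Type → Type
  | .pure, a => a
  | .io, a => Io a

def Eff.ret : (ε : Eff) → {a : Type} → a → ε.M a
  | .pure, _, x => x
  | .io, _, x => Io.ret x

def Eff.bind : (ε : Eff) → {a b : Type} → ε.M a → (a → ε.M b) → ε.M b
  | .pure, _, _, x, k => k x
  | .io, _, _, m, k => Io.bind m k

def backExp : {ε : Eff} → {G : TypEnv} → {e : Exp} → {a : QType} →
    Typing ε G e a → EvalEnv G → ε.M a.1
  | ε, _, _, _, .var n hn, g => ε.ret (g.lookup n hn)
  | ε, _, _, _, .unit, _ => ε.ret ()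
  | ε, _, _, _, .tru, _ => ε.ret true
  | ε, _, _, _, .fls, _ => ε.ret false
  | ε, _, _, _, .fileDescr fd, _ => ε.ret fd
  | ε, _, _, _, .string s, _ => ε.ret s
  | ε, _, _, _, .lam d, g => ε.ret (fun x => backExp d (g.push x))
  | ε, _, _, _, .lamIo d, g => ε.ret (fun x => backExp d (g.push x))
  | ε, _, _, _, .app d1 d2, g =>
      ε.bind (backExp d1 g) (fun f => ε.bind (backExp d2 g) (fun x => ε.ret (f x)))
  | _, _, _, _, .appIo d1 d2, g =>
      Io.bind (backExp d1 g) (fun f => Io.bind (backExp d2 g) (fun x => f x))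
  | ε, _, _, _, .ite d1 d2 d3, g =>
      ε.bind (backExp d1 g) (fun c => cond c (backExp d2 g) (backExp d3 g))
  | ε, _, _, _, .pair d1 d2, g =>
      ε.bind (backExp d1 g) (fun x => ε.bind (backExp d2 g) (fun y => ε.ret (x, y)))
  | ε, _, _, _, .fst d, g => ε.bind (backExp d g) (fun x => ε.ret x.1)
  | ε, _, _, _, .snd d, g => ε.bind (backExp d g) (fun x => ε.ret x.2)
  | ε, _, _, _, .inl d, g => ε.bind (backExp d g) (fun x => ε.ret (Sum.inl x))
  | ε, _, _, _, .inr d, g => ε.bind (backExp d g) (fun x => ε.ret (Sum.inr x))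
  | ε, _, _, _, .case d1 d2 d3, g =>
      ε.bind (backExp d1 g) (fun s =>
        Sum.elim (fun x => backExp d2 (g.push x)) (fun y => backExp d3 (g.push y)) s)
  | _, _, _, _, .read d, g => Io.bind (backExp d g) (fun fd => ioRead fd)
  | _, _, _, _, .write d1 d2, g =>
      Io.bind (backExp d1 g) (fun fd => Io.bind (backExp d2 g) (fun s => ioWrite fd s))
  | _, _, _, _, .openFile d, g => Io.bind (backExp d g) (fun s => ioOpen s)
  | _, _, _, _, .close d, g => Io.bind (backExp d g) (fun fd => ioClose fd)

/-! ### Partial programs, contexts, linking and whole programs -/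

/-- The interface shared by programs and contexts: the (quotable) type of the context. -/
structure Interface : Type 1 where
  ct : Type
  qtyp : TypeRep ct

abbrev Interface.qct (I : Interface) : QType := ⟨I.ct, I.qtyp⟩

/-- A partial source program: a function on contexts, with a derivation for it. -/
def ProgS (I : Interface) : Type 1 :=
  Σ ps : I.ct → Io Bool, TypingOVal [] (qArrIo I.qct qBool) (fun _ => ps)

/-- A source context is any inhabitant of the type in the interface. -/
def CtxS (I : Interface) : Type := I.ct

abbrev WholeS := Io Bool

def linkS {I : Interface} (P : ProgS I) (C : CtxS I) : WholeS := P.1 C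

/-- Target programs are untyped closed expressions. -/
def ProgT (_ : Interface) : Type := ClosedExp

/-- A target context: a value with a syntactic typing derivation at the type in the interface. -/
def CtxT (I : Interface) : Type 1 := Σ v : Value, Typing .pure [] v.1 I.qct

abbrev WholeT := ClosedExp

def linkT {I : Interface} (P : ProgT I) (C : CtxT I) : WholeT :=
  ⟨.app P.1 C.1.1, P.2, C.1.2.closed⟩

def compile {I : Interface} (P : ProgS I) : ProgT I := ⟨compileVal P.2, compileVal_closed P.2⟩

def backTranslate {I : Interface} (C : CtxT I) : CtxS I := backExp C.2 ()

/-- Behaviours: a local trace from the empty history, and a Boolean result. -/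
abbrev Behavior := LocalTrace [] × Bool

def SemS (W : WholeS) (t : Behavior) : Prop := FsBeh W [] t.1 t.2

def SemT (W : WholeT) (t : Behavior) : Prop :=
  EBeh W.1 (if t.2 then .tru else .fls) [] t.1

end SEIO

namespace SEIO

/-! ### Algebra of renamings and substitutions -/

namespace Exp

/-- Extend a parallel substitution by an expression for the variable `0`. -/
def consSub (v : Exp) (s : ℕ → Exp) : ℕ → Exp
  | 0 => v
  | n + 1 => s n

theorem liftSub_var : liftSub Exp.var = Exp.var := by
  funext n; cases n <;> rfl

theorem subst_var (e : Exp) : e.subst Exp.var = e := by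
  induction e <;> simp_all [Exp.subst, liftSub_var]

theorem liftSub_comp_liftRen (s : ℕ → Exp) (r : ℕ → ℕ) :
    liftSub s ∘ liftRen r = liftSub (s ∘ r) := by
  funext n; cases n <;> rfl

theorem subst_rename (e : Exp) : ∀ (s : ℕ → Exp) (r : ℕ → ℕ),
    (e.rename r).subst s = e.subst (s ∘ r) := by
  induction e <;> intro s r <;> simp_all [Exp.subst, Exp.rename, liftSub_comp_liftRen]

theorem rename_rename (e : Exp) : ∀ r r' : ℕ → ℕ,
    (e.rename r).rename r' = e.rename (r' ∘ r) := by
  have lift : ∀ r r' : ℕ → ℕ, liftRen r' ∘ liftRen r = liftRen (r' ∘ r) := by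
    intro r r'; funext n; cases n <;> rfl
  induction e <;> intro r r' <;> simp_all [Exp.rename]

theorem rename_liftSub (s : ℕ → Exp) (r : ℕ → ℕ) :
    (fun n => (liftSub s n).rename (liftRen r)) = liftSub (fun n => (s n).rename r) := by
  funext n
  cases n with
  | zero => rfl
  | succ n => simp only [liftSub, rename_rename]; rfl

theorem rename_subst (e : Exp) : ∀ (s : ℕ → Exp) (r : ℕ → ℕ),
    (e.subst s).rename r = e.subst (fun n => (s n).rename r) := by
  induction e <;> intro s r <;> simp_all [Exp.subst, Exp.rename, rename_liftSub]

theorem subst_liftSub (s s' : ℕ → Exp) :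
    (fun n => (liftSub s n).subst (liftSub s')) = liftSub (fun n => (s n).subst s') := by
  funext n
  cases n with
  | zero => rfl
  | succ n => simp only [liftSub, subst_rename, rename_subst]; rfl

theorem subst_subst (e : Exp) : ∀ s s' : ℕ → Exp,
    (e.subst s).subst s' = e.subst (fun n => (s n).subst s') := by
  induction e <;> intro s s' <;> simp_all [Exp.subst, subst_liftSub]

theorem substBeta_subst_liftSub (v e : Exp) (s : ℕ → Exp) :
    substBeta v (e.subst (liftSub s)) = e.subst (consSub v s) := by
  rw [substBeta, subst_subst]
  congr 1
  funext n
  cases n with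
  | zero => rfl
  | succ n => rw [liftSub, subst_rename]; exact subst_var _

theorem ClosedAt.subst : ∀ (e : Exp) {n m : ℕ} {s : ℕ → Exp},
    (∀ x, x < n → (s x).ClosedAt m) → e.ClosedAt n → (e.subst s).ClosedAt m := by
  have lift : ∀ {n m : ℕ} {s : ℕ → Exp}, (∀ x, x < n → (s x).ClosedAt m) →
      ∀ x, x < n + 1 → (liftSub s x).ClosedAt (m + 1) := by
    intro n m s hs x hx
    cases x with
    | zero => exact Nat.succ_pos m
    | succ x => exact (hs x (by omega)).rename _ (fun _ hy => Nat.succ_lt_succ hy)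
  intro e
  induction e with
  | var x => intro n m s hs h; exact hs x h
  | unit | tru | fls | fileDescr | string => intros; trivial
  | lam e ih => intro n m s hs h; exact ih (lift hs) h
  | app _ _ ih1 ih2 | pair _ _ ih1 ih2 | write _ _ ih1 ih2 =>
    intro n m s hs h; exact ⟨ih1 hs h.1, ih2 hs h.2⟩
  | ite _ _ _ ih1 ih2 ih3 => intro n m s hs h; exact ⟨ih1 hs h.1, ih2 hs h.2.1, ih3 hs h.2.2⟩
  | case _ _ _ ih1 ih2 ih3 =>
    intro n m s hs h; exact ⟨ih1 hs h.1, ih2 (lift hs) h.2.1, ih3 (lift hs) h.2.2⟩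
  | fst _ ih | snd _ ih | inl _ ih | inr _ ih | read _ ih | openFile _ ih | close _ ih =>
    intro n m s hs h; exact ih hs h

end Exp

theorem Typing.closed {ε : Eff} {G : TypEnv} {e : Exp} {a : QType} (d : Typing ε G e a) :
    e.ClosedAt G.length := by
  induction d with
  | var n hn => exact (List.getElem?_eq_some_iff.1 hn).1
  | unit | tru | fls | fileDescr | string => trivial
  | lam _ ih | lamIo _ ih | fst _ ih | snd _ ih | inl _ ih | inr _ ih | read _ ih
  | openFile _ ih | close _ ih => exact ih
  | app _ _ ih1 ih2 | appIo _ _ ih1 ih2 | pair _ _ ih1 ih2 | write _ _ ih1 ih2 => exact ⟨ih1, ih2⟩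
  | ite _ _ _ ih1 ih2 ih3 | case _ _ _ ih1 ih2 ih3 => exact ⟨ih1, ih2, ih3⟩

/-! ### Deterministic silent steps, operation steps and evaluation frames -/

theorem Step.not_isValue {e e' : Exp} {h : History} {oev : Option Event} (hs : Step e e' h oev) :
    ¬ e.IsValue := by
  induction hs with
  | pairLeft _ ih => exact fun hv => ih hv.1
  | pairRight _ _ ih => exact fun hv => ih hv.2
  | inl _ ih | inr _ ih => exact ih
  | _ => exact id

/-- From every history, the only step of `e` is a silent step to `e'`. -/
def SilentStep (e e' : Exp) : Prop :=
  ∀ e'' h oev, Step e e'' h oev ↔ oev = none ∧ e'' = e'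

/-- The steps of `e` perform the operation `o`, and continue according to its result. -/
def OpStep (e : Exp) (o : IoOp) (args : IoArgs o) (K : IoRes o → Exp) : Prop :=
  ∀ e'' h oev, Step e e'' h oev ↔
    ∃ r, IoPost h o args r ∧ oev = some (opToEv o args r) ∧ e'' = K r

theorem exists_ioPost (h : History) (o : IoOp) (args : IoArgs o) : ∃ r, IoPost h o args r := by
  cases o with
  | openFile =>
    exact ⟨.inr errMsg, fun _ he => (nomatch he), fun _ he => (Sum.inr.inj he).symm⟩
  | _ => exact ⟨Sum.inr errMsg, fun _ he => (Sum.inr.inj he).symm⟩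

/-- From every history, some step is possible. -/
def Exp.Reducible (e : Exp) : Prop := ∀ h, ∃ e' oev, Step e e' h oev

theorem SilentStep.reducible {e e' : Exp} (hs : SilentStep e e') : e.Reducible :=
  fun _ => ⟨e', none, (hs _ _ _).2 ⟨rfl, rfl⟩⟩

theorem OpStep.reducible {e : Exp} {o : IoOp} {args : IoArgs o} {K : IoRes o → Exp}
    (hs : OpStep e o args K) : e.Reducible := by
  intro h
  obtain ⟨r, hr⟩ := exists_ioPost h o args
  exact ⟨K r, some (opToEv o args r), (hs _ _ _).2 ⟨r, hr, rfl, rfl⟩⟩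

theorem Exp.Reducible.not_isValue {e : Exp} (he : e.Reducible) : ¬ e.IsValue := by
  obtain ⟨_, _, hs⟩ := he []
  exact hs.not_isValue

/-- Evaluation frames: the steps of `F e` are those of `e`, as long as `e` can step. -/
def IsFrame (F : Exp → Exp) : Prop :=
  ∀ e, e.Reducible → ∀ e'' h oev, Step (F e) e'' h oev ↔ ∃ e', Step e e' h oev ∧ e'' = F e'

theorem IsFrame.silentStep {F : Exp → Exp} (hF : IsFrame F) {e e' : Exp} (hs : SilentStep e e') :
    SilentStep (F e) (F e') := by
  intro e'' h oev
  rw [hF e hs.reducible]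
  simp [hs _ _ _]

theorem IsFrame.opStep {F : Exp → Exp} (hF : IsFrame F) {e : Exp} {o : IoOp} {args : IoArgs o}
    {K : IoRes o → Exp} (hs : OpStep e o args K) : OpStep (F e) o args (fun r => F (K r)) := by
  intro e'' h oev
  rw [hF e hs.reducible]
  constructor
  · rintro ⟨e', he, rfl⟩
    obtain ⟨r, h1, h2, rfl⟩ := (hs _ _ _).1 he
    exact ⟨r, h1, h2, rfl⟩
  · rintro ⟨r, h1, h2, rfl⟩
    exact ⟨K r, (hs _ _ _).2 ⟨r, h1, h2, rfl⟩, rfl⟩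

section Frames

theorem isFrame_appLeft (e2 : Exp) : IsFrame (fun e => .app e e2) := by
  intro e he e'' h oev
  constructor
  · intro hs
    cases hs with
    | appLeft hs => exact ⟨_, hs, rfl⟩
    | appRight hv hs => exact absurd hv he.not_isValue
    | beta hv => obtain ⟨_, _, hs⟩ := he []; cases hs
  · rintro ⟨e', hs, rfl⟩; exact .appLeft hs

theorem isFrame_appRight {v : Exp} (hv : v.IsValue) : IsFrame (.app v) := by
  intro e he e'' h oev
  constructor
  · intro hs
    cases hs with
    | appLeft hs => exact absurd hv hs.not_isValue
    | appRight _ hs => exact ⟨_, hs, rfl⟩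
    | beta hv => exact absurd hv he.not_isValue
  · rintro ⟨e', hs, rfl⟩; exact .appRight hv hs

theorem isFrame_ite (e1 e2 : Exp) : IsFrame (fun e => .ite e e1 e2) := by
  intro e he e'' h oev
  constructor
  · intro hs
    cases hs with
    | ite hs => exact ⟨_, hs, rfl⟩
    | iteTrue | iteFalse => exact absurd trivial he.not_isValue
  · rintro ⟨e', hs, rfl⟩; exact .ite hs

theorem isFrame_pairLeft (e2 : Exp) : IsFrame (fun e => .pair e e2) := by
  intro e he e'' h oev
  constructor
  · intro hs
    cases hs with
    | pairLeft hs => exact ⟨_, hs, rfl⟩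
    | pairRight hv hs => exact absurd hv he.not_isValue
  · rintro ⟨e', hs, rfl⟩; exact .pairLeft hs

theorem isFrame_pairRight {v : Exp} (hv : v.IsValue) : IsFrame (.pair v) := by
  intro e he e'' h oev
  constructor
  · intro hs
    cases hs with
    | pairLeft hs => exact absurd hv hs.not_isValue
    | pairRight _ hs => exact ⟨_, hs, rfl⟩
  · rintro ⟨e', hs, rfl⟩; exact .pairRight hv hs

theorem isFrame_fst : IsFrame .fst := by
  intro e he e'' h oev
  constructor
  · intro hs
    cases hs with
    | fst hs => exact ⟨_, hs, rfl⟩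
    | fstPair h1 h2 => exact absurd ⟨h1, h2⟩ he.not_isValue
  · rintro ⟨e', hs, rfl⟩; exact .fst hs

theorem isFrame_snd : IsFrame .snd := by
  intro e he e'' h oev
  constructor
  · intro hs
    cases hs with
    | snd hs => exact ⟨_, hs, rfl⟩
    | sndPair h1 h2 => exact absurd ⟨h1, h2⟩ he.not_isValue
  · rintro ⟨e', hs, rfl⟩; exact .snd hs

theorem isFrame_inl : IsFrame .inl := by
  intro e he e'' h oev
  constructor
  · intro hs
    cases hs with
    | inl hs => exact ⟨_, hs, rfl⟩
  · rintro ⟨e', hs, rfl⟩; exact .inl hs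

theorem isFrame_inr : IsFrame .inr := by
  intro e he e'' h oev
  constructor
  · intro hs
    cases hs with
    | inr hs => exact ⟨_, hs, rfl⟩
  · rintro ⟨e', hs, rfl⟩; exact .inr hs

theorem isFrame_case (e1 e2 : Exp) : IsFrame (fun e => .case e e1 e2) := by
  intro e he e'' h oev
  constructor
  · intro hs
    cases hs with
    | case hs => exact ⟨_, hs, rfl⟩
    | caseInl hv | caseInr hv => exact absurd hv he.not_isValue
  · rintro ⟨e', hs, rfl⟩; exact .case hs

theorem isFrame_read : IsFrame .read := by
  intro e he e'' h oev
  constructor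
  · intro hs
    cases hs with
    | read hs => exact ⟨_, hs, rfl⟩
    | readSuccess | readFail => exact absurd trivial he.not_isValue
  · rintro ⟨e', hs, rfl⟩; exact .read hs

theorem isFrame_writeLeft (e2 : Exp) : IsFrame (fun e => .write e e2) := by
  intro e he e'' h oev
  constructor
  · intro hs
    cases hs with
    | writeLeft hs => exact ⟨_, hs, rfl⟩
    | writeRight hv hs => exact absurd hv he.not_isValue
    | writeSuccess | writeFail => exact absurd trivial he.not_isValue
  · rintro ⟨e', hs, rfl⟩; exact .writeLeft hs

theorem isFrame_writeRight {v : Exp} (hv : v.IsValue) : IsFrame (.write v) := by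
  intro e he e'' h oev
  constructor
  · intro hs
    cases hs with
    | writeLeft hs => exact absurd hv hs.not_isValue
    | writeRight _ hs => exact ⟨_, hs, rfl⟩
    | writeSuccess | writeFail => exact absurd trivial he.not_isValue
  · rintro ⟨e', hs, rfl⟩; exact .writeRight hv hs

theorem isFrame_openFile : IsFrame .openFile := by
  intro e he e'' h oev
  constructor
  · intro hs
    cases hs with
    | openFile hs => exact ⟨_, hs, rfl⟩
    | openSuccess | openFail => exact absurd trivial he.not_isValue
  · rintro ⟨e', hs, rfl⟩; exact .openFile hs

theorem isFrame_close : IsFrame .close := by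
  intro e he e'' h oev
  constructor
  · intro hs
    cases hs with
    | close hs => exact ⟨_, hs, rfl⟩
    | closeSuccess | closeFail => exact absurd trivial he.not_isValue
  · rintro ⟨e', hs, rfl⟩; exact .close hs

end Frames

section Redexes

theorem silentStep_beta {e v : Exp} (he : e.ClosedAt 1) (hv : v.IsValue) :
    SilentStep (.app (.lam e) v) (substBeta v e) := by
  intro e'' h oev
  constructor
  · intro hs
    cases hs with
    | appLeft hs => exact absurd he hs.not_isValue
    | appRight _ hs => exact absurd hv hs.not_isValue
    | beta => exact ⟨rfl, rfl⟩
  · rintro ⟨rfl, rfl⟩; exact .beta hv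

theorem silentStep_ite (b : Bool) (e1 e2 : Exp) :
    SilentStep (.ite (if b then .tru else .fls) e1 e2) (cond b e1 e2) := by
  intro e'' h oev
  cases b
  · constructor
    · intro hs
      cases hs with
      | ite hs => exact absurd trivial hs.not_isValue
      | iteFalse => exact ⟨rfl, rfl⟩
    · rintro ⟨rfl, rfl⟩; exact .iteFalse
  · constructor
    · intro hs
      cases hs with
      | ite hs => exact absurd trivial hs.not_isValue
      | iteTrue => exact ⟨rfl, rfl⟩
    · rintro ⟨rfl, rfl⟩; exact .iteTrue

theorem silentStep_fst {v1 v2 : Exp} (h1 : v1.IsValue) (h2 : v2.IsValue) :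
    SilentStep (.fst (.pair v1 v2)) v1 := by
  intro e'' h oev
  constructor
  · intro hs
    cases hs with
    | fst hs => exact absurd ⟨h1, h2⟩ hs.not_isValue
    | fstPair => exact ⟨rfl, rfl⟩
  · rintro ⟨rfl, rfl⟩; exact .fstPair h1 h2

theorem silentStep_snd {v1 v2 : Exp} (h1 : v1.IsValue) (h2 : v2.IsValue) :
    SilentStep (.snd (.pair v1 v2)) v2 := by
  intro e'' h oev
  constructor
  · intro hs
    cases hs with
    | snd hs => exact absurd ⟨h1, h2⟩ hs.not_isValue
    | sndPair => exact ⟨rfl, rfl⟩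
  · rintro ⟨rfl, rfl⟩; exact .sndPair h1 h2

theorem silentStep_caseInl {v : Exp} (hv : v.IsValue) (e1 e2 : Exp) :
    SilentStep (.case (.inl v) e1 e2) (substBeta v e1) := by
  intro e'' h oev
  constructor
  · intro hs
    cases hs with
    | case hs => exact absurd hv hs.not_isValue
    | caseInl => exact ⟨rfl, rfl⟩
  · rintro ⟨rfl, rfl⟩; exact .caseInl hv

theorem silentStep_caseInr {v : Exp} (hv : v.IsValue) (e1 e2 : Exp) :
    SilentStep (.case (.inr v) e1 e2) (substBeta v e2) := by
  intro e'' h oev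
  constructor
  · intro hs
    cases hs with
    | case hs => exact absurd hv hs.not_isValue
    | caseInr => exact ⟨rfl, rfl⟩
  · rintro ⟨rfl, rfl⟩; exact .caseInr hv

/-- The value that represents the result of an operation. -/
def resExp {a : Type} (f : a → Exp) : ResExn a → Exp
  | .inl x => .inl (f x)
  | .inr e => .inr (.string e)

theorem opStep_read (fd : FileDescr) :
    OpStep (.read (.fileDescr fd)) .read fd (resExp .string) := by
  intro e'' h oev
  constructor
  · intro hs
    cases hs with
    | read hs => exact absurd trivial hs.not_isValue
    | readSuccess _ s => exact ⟨.inl s, fun _ he => (nomatch he), rfl, rfl⟩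
    | readFail => exact ⟨.inr errMsg, fun _ he => (Sum.inr.inj he).symm, rfl, rfl⟩
  · rintro ⟨r | r, hr, rfl, rfl⟩
    · exact .readSuccess _ _ _
    · obtain rfl := hr r rfl; exact .readFail _ _

theorem opStep_write (fd : FileDescr) (s : String) :
    OpStep (.write (.fileDescr fd) (.string s)) .write (fd, s) (resExp (fun _ : Unit => .unit)) := by
  intro e'' h oev
  constructor
  · intro hs
    cases hs with
    | writeLeft hs => exact absurd trivial hs.not_isValue
    | writeRight _ hs => exact absurd trivial hs.not_isValue
    | writeSuccess => exact ⟨.inl (), fun _ he => (nomatch he), rfl, rfl⟩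
    | writeFail => exact ⟨.inr errMsg, fun _ he => (Sum.inr.inj he).symm, rfl, rfl⟩
  · rintro ⟨r | r, hr, rfl, rfl⟩
    · exact .writeSuccess _ _ _
    · obtain rfl := hr r rfl; exact .writeFail _ _ _

theorem opStep_openFile (s : String) :
    OpStep (.openFile (.string s)) .openFile s (resExp .fileDescr) := by
  intro e'' h oev
  constructor
  · intro hs
    cases hs with
    | openFile hs => exact absurd trivial hs.not_isValue
    | openSuccess =>
      exact ⟨.inl (freshFd h), ⟨fun _ he => (Sum.inl.inj he).symm, fun _ he => (nomatch he)⟩,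
        rfl, rfl⟩
    | openFail =>
      exact ⟨.inr errMsg, ⟨fun _ he => (nomatch he), fun _ he => (Sum.inr.inj he).symm⟩, rfl, rfl⟩
  · rintro ⟨r | r, hr, rfl, rfl⟩
    · obtain rfl := hr.1 r rfl; exact .openSuccess _ _
    · obtain rfl := hr.2 r rfl; exact .openFail _ _

theorem opStep_close (fd : FileDescr) :
    OpStep (.close (.fileDescr fd)) .close fd (resExp (fun _ : Unit => .unit)) := by
  intro e'' h oev
  constructor
  · intro hs
    cases hs with
    | close hs => exact absurd trivial hs.not_isValue
    | closeSuccess => exact ⟨.inl (), fun _ he => (nomatch he), rfl, rfl⟩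
    | closeFail => exact ⟨.inr errMsg, fun _ he => (Sum.inr.inj he).symm, rfl, rfl⟩
  · rintro ⟨r | r, hr, rfl, rfl⟩
    · exact .closeSuccess _ _
    · obtain rfl := hr r rfl; exact .closeFail _ _

end Redexes

/-! ### Simulation between expressions and computations -/

/-- The expression performs the same operations as the computation, up to silent steps, and their
results are related by `R`. -/
inductive Sim {α : Type} (R : Exp → α → Prop) : Exp → Io α → Prop
  | ret {v : Exp} {x : α} : R v x → Sim R v (.ret x)
  | silent {e e' : Exp} {m : Io α} : SilentStep e e' → Sim R e' m → Sim R e m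
  | call {e : Exp} {o : IoOp} {args : IoArgs o} {K : IoRes o → Exp} {k : IoRes o → Io α} :
      OpStep e o args K → (∀ r, Sim R (K r) (k r)) → Sim R e (.call o args k)

theorem Sim.bind {α β : Type} {R : Exp → α → Prop} {S : Exp → β → Prop} {F : Exp → Exp}
    {k : α → Io β} {e : Exp} {m : Io α} (he : Sim R e m) (hF : IsFrame F)
    (hk : ∀ v x, R v x → Sim S (F v) (k x)) : Sim S (F e) (m.bind k) := by
  induction he with
  | ret hv => exact hk _ _ hv
  | silent hs _ ih => exact .silent (hF.silentStep hs) ih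
  | call hs _ ih => exact .call (hF.opStep hs) ih

/-! ### The logical relation between target values and source values -/

/-- The target values that behave like a source value of a quotable type. -/
def TypeRep.Rel : {a : Type} → TypeRep a → Exp → a → Prop
  | _, .unit => fun v _ => v = .unit
  | _, .bool => fun v b => v = if b then .tru else .fls
  | _, .fileDescr => fun v fd => v = .fileDescr fd
  | _, .string => fun v s => v = .string s
  | _, .arr qa qb => fun v f => ∃ e : Exp, v = .lam e ∧ e.ClosedAt 1 ∧
      ∀ w x, qa.Rel w x → Sim qb.Rel (substBeta w e) (.ret (f x))
  | _, .arrIo qa qb => fun v f => ∃ e : Exp, v = .lam e ∧ e.ClosedAt 1 ∧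
      ∀ w x, qa.Rel w x → Sim qb.Rel (substBeta w e) (f x)
  | _, .pair qa qb => fun v p => ∃ v1 v2, v = .pair v1 v2 ∧ qa.Rel v1 p.1 ∧ qb.Rel v2 p.2
  | _, .sum qa qb => fun v s =>
      Sum.elim (fun x => ∃ w, v = .inl w ∧ qa.Rel w x) (fun y => ∃ w, v = .inr w ∧ qb.Rel w y) s

theorem TypeRep.Rel.isValue : {a : Type} → (q : TypeRep a) → {v : Exp} → {x : a} →
    q.Rel v x → v.IsValue
  | _, .unit, _, _, h => by cases h; trivial
  | _, .bool, _, b, h => by cases h; cases b <;> trivial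
  | _, .fileDescr, _, _, h => by cases h; trivial
  | _, .string, _, _, h => by cases h; trivial
  | _, .arr _ _, _, _, h => by obtain ⟨e, rfl, he, _⟩ := h; exact he
  | _, .arrIo _ _, _, _, h => by obtain ⟨e, rfl, he, _⟩ := h; exact he
  | _, .pair qa qb, _, _, h => by
    obtain ⟨v1, v2, rfl, h1, h2⟩ := h
    exact ⟨TypeRep.Rel.isValue qa h1, TypeRep.Rel.isValue qb h2⟩
  | _, .sum qa qb, _, s, h => by
    rcases s with s | s
    · obtain ⟨w, rfl, hw⟩ := h; exact TypeRep.Rel.isValue (v := w) qa hw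
    · obtain ⟨w, rfl, hw⟩ := h; exact TypeRep.Rel.isValue (v := w) qb hw

/-- Substitutions that replace the variables of `G` by values related to an environment. -/
def EnvRel : (G : TypEnv) → (ℕ → Exp) → EvalEnv G → Prop
  | [], _, _ => True
  | a :: G, s, g => a.2.Rel (s 0) (EvalEnv.hd g) ∧ EnvRel G (fun n => s (n + 1)) (EvalEnv.tail g)

theorem EnvRel.lookup : {G : TypEnv} → {s : ℕ → Exp} → {g : EvalEnv G} → EnvRel G s g → (n : ℕ) →
    {a : QType} → (h : G[n]? = some a) → a.2.Rel (s n) (g.lookup n h)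
  | [], _, _, _, _, _, h => by simp at h
  | _ :: _, _, _, hg, 0, _, h => by
    cases Option.some.inj h
    exact hg.1
  | _ :: _, _, _, hg, n + 1, _, h => EnvRel.lookup hg.2 n (by simpa using h)

theorem EnvRel.closed : {G : TypEnv} → {s : ℕ → Exp} → {g : EvalEnv G} → EnvRel G s g → (n : ℕ) →
    n < G.length → (s n).ClosedAt 0
  | _ :: _, _, _, hg, 0, _ => (TypeRep.Rel.isValue _ hg.1).closed
  | _ :: _, _, _, hg, n + 1, h => EnvRel.closed hg.2 n (Nat.lt_of_succ_lt_succ h)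

theorem EnvRel.push {G : TypEnv} {a : QType} {s : ℕ → Exp} {g : EvalEnv G} (hg : EnvRel G s g)
    {v : Exp} {x : a.1} (hv : a.2.Rel v x) : EnvRel (a :: G) (Exp.consSub v s) (g.push x) :=
  ⟨hv, hg⟩

theorem EnvRel.closedAt_one {G : TypEnv} {a : QType} {s : ℕ → Exp} {g : EvalEnv G}
    (hg : EnvRel G s g) {e : Exp} (he : e.ClosedAt (a :: G).length) :
    (e.subst (liftSub s)).ClosedAt 1 :=
  Exp.ClosedAt.subst (.lam e) (m := 0) hg.closed he

/-! ### Compatibility of the simulation with the constructs of the target calculus -/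

section Compatibility

variable {a b c : Type} {qa : TypeRep a} {qb : TypeRep b} {qc : TypeRep c}

theorem Sim.app {e1 e2 : Exp} {m1 : Io (a → b)} {m2 : Io a} (h1 : Sim (TypeRep.arr qa qb).Rel e1 m1)
    (h2 : Sim qa.Rel e2 m2) :
    Sim qb.Rel (.app e1 e2) (m1.bind fun f => m2.bind fun x => .ret (f x)) := by
  refine h1.bind (isFrame_appLeft e2) ?_
  rintro _ f ⟨e, rfl, he, hf⟩
  refine h2.bind (isFrame_appRight (v := .lam e) he) fun v x hv => ?_
  exact .silent (silentStep_beta he (TypeRep.Rel.isValue _ hv)) (hf _ _ hv)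

theorem Sim.appIo {e1 e2 : Exp} {m1 : Io (a → Io b)} {m2 : Io a}
    (h1 : Sim (TypeRep.arrIo qa qb).Rel e1 m1) (h2 : Sim qa.Rel e2 m2) :
    Sim qb.Rel (.app e1 e2) (m1.bind fun f => m2.bind fun x => f x) := by
  refine h1.bind (isFrame_appLeft e2) ?_
  rintro _ f ⟨e, rfl, he, hf⟩
  refine h2.bind (isFrame_appRight (v := .lam e) he) fun v x hv => ?_
  exact .silent (silentStep_beta he (TypeRep.Rel.isValue _ hv)) (hf _ _ hv)

theorem Sim.ite {R : Exp → a → Prop} {e1 e2 e3 : Exp} {m1 : Io Bool} {m2 m3 : Io a}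
    (h1 : Sim TypeRep.bool.Rel e1 m1) (h2 : Sim R e2 m2) (h3 : Sim R e3 m3) :
    Sim R (.ite e1 e2 e3) (m1.bind fun c => cond c m2 m3) := by
  refine h1.bind (isFrame_ite e2 e3) ?_
  rintro _ b rfl
  refine .silent (silentStep_ite b e2 e3) ?_
  cases b
  · exact h3
  · exact h2

theorem Sim.pair {e1 e2 : Exp} {m1 : Io a} {m2 : Io b} (h1 : Sim qa.Rel e1 m1)
    (h2 : Sim qb.Rel e2 m2) :
    Sim (TypeRep.pair qa qb).Rel (.pair e1 e2) (m1.bind fun x => m2.bind fun y => .ret (x, y)) := by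
  refine h1.bind (isFrame_pairLeft e2) fun v x hv => ?_
  refine h2.bind (isFrame_pairRight (TypeRep.Rel.isValue _ hv)) fun w y hw => ?_
  exact .ret ⟨v, w, rfl, hv, hw⟩

theorem Sim.fst {e : Exp} {m : Io (a × b)} (h : Sim (TypeRep.pair qa qb).Rel e m) :
    Sim qa.Rel (.fst e) (m.bind fun x => .ret x.1) := by
  refine h.bind isFrame_fst ?_
  rintro _ x ⟨v, w, rfl, hv, hw⟩
  exact .silent (silentStep_fst (TypeRep.Rel.isValue _ hv) (TypeRep.Rel.isValue _ hw)) (.ret hv)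

theorem Sim.snd {e : Exp} {m : Io (a × b)} (h : Sim (TypeRep.pair qa qb).Rel e m) :
    Sim qb.Rel (.snd e) (m.bind fun x => .ret x.2) := by
  refine h.bind isFrame_snd ?_
  rintro _ x ⟨v, w, rfl, hv, hw⟩
  exact .silent (silentStep_snd (TypeRep.Rel.isValue _ hv) (TypeRep.Rel.isValue _ hw)) (.ret hw)

theorem Sim.inl {e : Exp} {m : Io a} (h : Sim qa.Rel e m) :
    Sim (TypeRep.sum qa qb).Rel (.inl e) (m.bind fun x => .ret (Sum.inl x)) :=
  h.bind isFrame_inl fun v _ hv => .ret ⟨v, rfl, hv⟩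

theorem Sim.inr {e : Exp} {m : Io b} (h : Sim qb.Rel e m) :
    Sim (TypeRep.sum qa qb).Rel (.inr e) (m.bind fun x => .ret (Sum.inr x)) :=
  h.bind isFrame_inr fun v _ hv => .ret ⟨v, rfl, hv⟩

theorem Sim.case {e1 e2 e3 : Exp} {m : Io (a ⊕ b)} {l : a → Io c} {r : b → Io c}
    (h1 : Sim (TypeRep.sum qa qb).Rel e1 m)
    (h2 : ∀ v x, qa.Rel v x → Sim qc.Rel (substBeta v e2) (l x))
    (h3 : ∀ v y, qb.Rel v y → Sim qc.Rel (substBeta v e3) (r y)) :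
    Sim qc.Rel (.case e1 e2 e3) (m.bind fun s => Sum.elim l r s) := by
  refine h1.bind (isFrame_case e2 e3) ?_
  rintro v (x | y) hv
  · obtain ⟨w, rfl, hw⟩ := hv
    exact .silent (silentStep_caseInl (TypeRep.Rel.isValue _ hw) e2 e3) (h2 _ _ hw)
  · obtain ⟨w, rfl, hw⟩ := hv
    exact .silent (silentStep_caseInr (TypeRep.Rel.isValue _ hw) e2 e3) (h3 _ _ hw)

theorem Sim.letIn {e1 e2 : Exp} {m : Io a} {k : a → Io b} (he : e2.ClosedAt 1)
    (h1 : Sim qa.Rel e1 m) (h2 : ∀ v x, qa.Rel v x → Sim qb.Rel (substBeta v e2) (k x)) :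
    Sim qb.Rel (.app (.lam e2) e1) (m.bind k) :=
  h1.bind (isFrame_appRight (v := .lam e2) he) fun _ _ hv =>
    .silent (silentStep_beta he (TypeRep.Rel.isValue _ hv)) (h2 _ _ hv)

theorem rel_resExp {f : a → Exp} (hf : ∀ x, qa.Rel (f x) x) (r : ResExn a) :
    (TypeRep.sum qa .string).Rel (resExp f r) r := by
  rcases r with x | e
  · exact ⟨_, rfl, hf x⟩
  · exact ⟨_, rfl, rfl⟩

theorem Sim.read {e : Exp} {m : Io FileDescr} (h : Sim TypeRep.fileDescr.Rel e m) :
    Sim (TypeRep.sum .string .string).Rel (.read e) (m.bind fun fd => ioRead fd) := by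
  refine h.bind isFrame_read ?_
  rintro _ fd rfl
  exact .call (opStep_read fd) fun r => .ret (rel_resExp (qa := .string) (fun _ => rfl) r)

theorem Sim.write {e1 e2 : Exp} {m1 : Io FileDescr} {m2 : Io String}
    (h1 : Sim TypeRep.fileDescr.Rel e1 m1) (h2 : Sim TypeRep.string.Rel e2 m2) :
    Sim (TypeRep.sum .unit .string).Rel (.write e1 e2)
      (m1.bind fun fd => m2.bind fun s => ioWrite fd s) := by
  refine h1.bind (isFrame_writeLeft e2) ?_
  rintro _ fd rfl
  refine h2.bind (isFrame_writeRight (v := .fileDescr fd) trivial) ?_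
  rintro _ s rfl
  exact .call (opStep_write fd s) fun r => .ret (rel_resExp (qa := .unit) (fun _ => rfl) r)

theorem Sim.openFile {e : Exp} {m : Io String} (h : Sim TypeRep.string.Rel e m) :
    Sim (TypeRep.sum .fileDescr .string).Rel (.openFile e) (m.bind fun s => ioOpen s) := by
  refine h.bind isFrame_openFile ?_
  rintro _ s rfl
  exact .call (opStep_openFile s) fun r => .ret (rel_resExp (qa := .fileDescr) (fun _ => rfl) r)

theorem Sim.close {e : Exp} {m : Io FileDescr} (h : Sim TypeRep.fileDescr.Rel e m) :
    Sim (TypeRep.sum .unit .string).Rel (.close e) (m.bind fun fd => ioClose fd) := by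
  refine h.bind isFrame_close ?_
  rintro _ fd rfl
  exact .call (opStep_close fd) fun r => .ret (rel_resExp (qa := .unit) (fun _ => rfl) r)

end Compatibility

/-! ### Compiled derivations simulate their denotations -/

mutual

theorem sim_compileVal : {G : TypEnv} → {a : QType} → {x : EvalEnv G → a.1} →
    (d : TypingOVal G a x) → {s : ℕ → Exp} → {g : EvalEnv G} → EnvRel G s g →
    Sim a.2.Rel ((compileVal d).subst s) (.ret (x g))
  | _, _, _, .qtt, _, _, _ => .ret rfl
  | _, _, _, .qtrue, _, _, _ => .ret rfl
  | _, _, _, .qfalse, _, _, _ => .ret rfl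
  | _, _, _, .qstringLit _, _, _, _ => .ret rfl
  | _, _, _, .qvar0, _, _, hg => .ret hg.1
  | _, _, _, .qvarS d, s, _, hg => by
    rw [compileVal, Exp.subst_rename]
    exact sim_compileVal d hg.2
  | _, _, _, .qapp d1 d2, _, _, hg => (sim_compileVal d1 hg).app (sim_compileVal d2 hg)
  | _, _, _, .qlambda d, s, _, hg =>
    .ret ⟨_, rfl, hg.closedAt_one (compileVal_closed d), fun w x hw => by
      rw [Exp.substBeta_subst_liftSub]
      exact sim_compileVal d (hg.push hw)⟩
  | _, _, _, .qlambdaIo d, s, _, hg =>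
    .ret ⟨_, rfl, hg.closedAt_one (compileProd_closed d), fun w x hw => by
      rw [Exp.substBeta_subst_liftSub]
      exact sim_compileProd d (hg.push hw)⟩
  | _, _, _, .qif (c := c) d1 d2 d3, _, g, hg => by
    have h := (sim_compileVal d1 hg).ite (sim_compileVal d2 hg) (sim_compileVal d3 hg)
    dsimp only [Io.bind] at h ⊢
    rw [← Bool.apply_cond Io.ret] at h
    exact h
  | _, _, _, .qmkpair d1 d2, _, _, hg => (sim_compileVal d1 hg).pair (sim_compileVal d2 hg)
  | _, _, _, .qfst d, _, _, hg => (sim_compileVal d hg).fst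
  | _, _, _, .qsnd d, _, _, hg => (sim_compileVal d hg).snd
  | _, _, _, .qinl d, _, _, hg => (sim_compileVal d hg).inl
  | _, _, _, .qinr d, _, _, hg => (sim_compileVal d hg).inr
  | _, _, _, .qcase (sc := sc) (il := il) (ir := ir) d1 d2 d3, s, g, hg => by
    have h := (sim_compileVal d1 hg).case (e2 := (compileVal d2).subst (liftSub s))
      (e3 := (compileVal d3).subst (liftSub s))
      (l := fun x => .ret (il (g.push x))) (r := fun y => .ret (ir (g.push y)))
      (fun v x hv => by
        rw [Exp.substBeta_subst_liftSub]; exact sim_compileVal d2 (hg.push hv))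
      (fun v x hv => by
        rw [Exp.substBeta_subst_liftSub]; exact sim_compileVal d3 (hg.push hv))
    dsimp only [Io.bind] at h ⊢
    rcases hs : sc g with x | y <;> rw [hs] at h <;> exact h

theorem sim_compileProd : {G : TypEnv} → {a : QType} → {m : EvalEnv G → Io a.1} →
    (d : TypingOProd G a m) → {s : ℕ → Exp} → {g : EvalEnv G} → EnvRel G s g →
    Sim a.2.Rel ((compileProd d).subst s) (m g)
  | _, _, _, .qreturn d, _, _, hg => sim_compileVal d hg
  | _, _, _, .qbind d1 d2, _, _, hg =>
    (sim_compileProd d1 hg).letIn (hg.closedAt_one (compileProd_closed d2)) fun _ _ hv => by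
      rw [Exp.substBeta_subst_liftSub]
      exact sim_compileProd d2 (hg.push hv)
  | _, _, _, .qappIo d1 d2, _, _, hg => (sim_compileVal d1 hg).appIo (sim_compileVal d2 hg)
  | _, _, _, .qifIo d1 d2 d3, _, _, hg =>
    (sim_compileVal d1 hg).ite (sim_compileProd d2 hg) (sim_compileProd d3 hg)
  | _, _, _, .qcaseIo d1 d2 d3, _, _, hg =>
    (sim_compileVal d1 hg).case
      (fun _ _ hv => by
        rw [Exp.substBeta_subst_liftSub]; exact sim_compileProd d2 (hg.push hv))
      (fun _ _ hv => by
        rw [Exp.substBeta_subst_liftSub]; exact sim_compileProd d3 (hg.push hv))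
  | _, _, _, .qread d, _, _, hg => (sim_compileVal d hg).read
  | _, _, _, .qwrite d1 d2, _, _, hg => (sim_compileVal d1 hg).write (sim_compileVal d2 hg)
  | _, _, _, .qopenfile d, _, _, hg => (sim_compileVal d hg).openFile
  | _, _, _, .qclose d, _, _, hg => (sim_compileVal d hg).close

end

/-! ### Typed target expressions simulate their back-translations -/

/-- Regard pure values as computations. -/
def Eff.toIo : (ε : Eff) → {a : Type} → ε.M a → Io a
  | .pure, _, x => .ret x
  | .io, _, m => m

theorem Eff.toIo_ret (ε : Eff) {a : Type} (x : a) : ε.toIo (ε.ret x) = .ret x := by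
  cases ε <;> rfl

theorem Eff.toIo_bind (ε : Eff) {a b : Type} (m : ε.M a) (k : a → ε.M b) :
    ε.toIo (ε.bind m k) = (ε.toIo m).bind fun x => ε.toIo (k x) := by
  cases ε <;> rfl

theorem sim_toIo_ret (ε : Eff) {a : Type} {R : Exp → a → Prop} {v : Exp} {x : a} (hv : R v x) :
    Sim R v (ε.toIo (ε.ret x)) := by
  rw [Eff.toIo_ret]; exact .ret hv

theorem sim_backExp {ε : Eff} {G : TypEnv} {e : Exp} {a : QType} (d : Typing ε G e a) :
    ∀ {s : ℕ → Exp} {g : EvalEnv G}, EnvRel G s g →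
      Sim a.2.Rel (e.subst s) (ε.toIo (backExp d g)) := by
  induction d with
  | var n hn =>
    intro s g hg; exact sim_toIo_ret _ (hg.lookup n hn)
  | unit | tru | fls | fileDescr | string =>
    intro s g hg; exact sim_toIo_ret _ rfl
  | lam d ih =>
    intro s g hg
    refine sim_toIo_ret _ ⟨_, rfl, hg.closedAt_one d.closed, fun w x hw => ?_⟩
    rw [Exp.substBeta_subst_liftSub]
    exact ih (hg.push hw)
  | lamIo d ih =>
    intro s g hg
    refine sim_toIo_ret _ ⟨_, rfl, hg.closedAt_one d.closed, fun w x hw => ?_⟩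
    rw [Exp.substBeta_subst_liftSub]
    exact ih (hg.push hw)
  | app d1 d2 ih1 ih2 =>
    intro s g hg
    simp only [backExp, Eff.toIo_ret, Eff.toIo_bind]
    exact (ih1 hg).app (ih2 hg)
  | appIo d1 d2 ih1 ih2 => intro s g hg; exact (ih1 hg).appIo (ih2 hg)
  | @ite ε _ _ _ _ _ d1 d2 d3 ih1 ih2 ih3 =>
    intro s g hg
    simp only [backExp, Eff.toIo_bind, Bool.apply_cond (Eff.toIo ε)]
    exact (ih1 hg).ite (ih2 hg) (ih3 hg)
  | pair d1 d2 ih1 ih2 =>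
    intro s g hg
    simp only [backExp, Eff.toIo_ret, Eff.toIo_bind]
    exact (ih1 hg).pair (ih2 hg)
  | fst d ih =>
    intro s g hg
    simp only [backExp, Eff.toIo_ret, Eff.toIo_bind]
    exact (ih hg).fst
  | snd d ih =>
    intro s g hg
    simp only [backExp, Eff.toIo_ret, Eff.toIo_bind]
    exact (ih hg).snd
  | inl d ih =>
    intro s g hg
    simp only [backExp, Eff.toIo_ret, Eff.toIo_bind]
    exact (ih hg).inl
  | inr d ih =>
    intro s g hg
    simp only [backExp, Eff.toIo_ret, Eff.toIo_bind]
    exact (ih hg).inr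
  | @case ε _ _ _ _ _ _ _ d1 d2 d3 ih1 ih2 ih3 =>
    intro s g hg
    simp only [backExp, Eff.toIo_bind]
    have helim : ∀ t, ε.toIo (Sum.elim (fun x => backExp d2 (g.push x))
        (fun y => backExp d3 (g.push y)) t) = Sum.elim (fun x => ε.toIo (backExp d2 (g.push x)))
        (fun y => ε.toIo (backExp d3 (g.push y))) t := by rintro (x | y) <;> rfl
    simp only [helim]
    refine (ih1 hg).case (fun v x hv => ?_) (fun v x hv => ?_)
    · rw [Exp.substBeta_subst_liftSub]; exact ih2 (hg.push hv)
    · rw [Exp.substBeta_subst_liftSub]; exact ih3 (hg.push hv)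
  | read d ih => intro s g hg; exact (ih hg).read
  | write d1 d2 ih1 ih2 => intro s g hg; exact (ih1 hg).write (ih2 hg)
  | openFile d ih => intro s g hg; exact (ih hg).openFile
  | close d ih => intro s g hg; exact (ih hg).close

/-! ### Behaviours of computations -/

/-- The traces and results of a computation, by recursion on the computation. -/
def Io.Beh {a : Type} : Io a → History → Trace → a → Prop
  | .ret x, _, lt, r => lt = [] ∧ r = x
  | .call o args k, h, lt, r => ∃ (res : IoRes o) (lt' : Trace), IoPost h o args res ∧
      lt = opToEv o args res :: lt' ∧ (k res).Beh (opToEv o args res :: h) lt' r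

theorem theta_beh {a : Type} (m : Io a) :
    ∀ h : History, (theta m).1 h (fun lt r => m.Beh h lt.1 r) := by
  induction m with
  | ret x => intro h; exact ⟨rfl, rfl⟩
  | call o args k ih =>
    rintro h ⟨lt, hlt⟩ r ⟨hr, rfl⟩
    exact (theta (k r)).2 _ _ _ (fun lt' x hx => ⟨r, lt'.1, hr, rfl, hx⟩) (ih r _)

theorem Io.Beh.of_theta {a : Type} (m : Io a) : ∀ {h : History} {p : HistPost h a},
    (theta m).1 h p → ∀ (lt : LocalTrace h) (r : a), m.Beh h lt.1 r → p lt r := by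
  induction m with
  | ret x =>
    rintro h p hp ⟨lt, hlt⟩ r ⟨rfl, rfl⟩
    exact hp
  | call o args k ih =>
    rintro h p hp ⟨lt, hlt⟩ r ⟨res, lt', hres, rfl, hb⟩
    exact ih res (hp ⟨[opToEv o args res], hlt.1, trivial⟩ res ⟨hres, rfl⟩) ⟨lt', hlt.2⟩ r hb

theorem fsBeh_iff {a : Type} (m : Io a) (h : History) (lt : LocalTrace h) (r : a) :
    FsBeh m h lt r ↔ m.Beh h lt.1 r :=
  ⟨fun hb => hb _ (theta_beh m h), fun hb _ hp => hb.of_theta m hp lt r⟩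

/-! ### Adequacy of the simulation -/

theorem Steps.eq_of_isValue {v e : Exp} {h : History} {lt : Trace} (hs : Steps v e h lt)
    (hv : v.IsValue) : lt = [] ∧ e = v := by
  cases hs with
  | refl => exact ⟨rfl, rfl⟩
  | trans hs _ => exact absurd hv hs.not_isValue

theorem SilentStep.steps_iff {e e' v : Exp} (hs : SilentStep e e') (hv : v.IsValue) (h : History)
    (lt : Trace) : Steps e v h lt ↔ Steps e' v h lt := by
  constructor
  · intro hst
    cases hst with
    | refl => exact absurd hv hs.reducible.not_isValue
    | trans h1 h2 =>
      obtain ⟨rfl, rfl⟩ := (hs _ _ _).1 h1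
      exact h2
  · intro hst
    exact .trans (oev := none) ((hs _ _ _).2 ⟨rfl, rfl⟩) hst

theorem OpStep.steps_iff {e v : Exp} {o : IoOp} {args : IoArgs o} {K : IoRes o → Exp}
    (hs : OpStep e o args K) (hv : v.IsValue) (h : History) (lt : Trace) :
    Steps e v h lt ↔ ∃ (r : IoRes o) (lt' : Trace), IoPost h o args r ∧
      lt = opToEv o args r :: lt' ∧ Steps (K r) v (opToEv o args r :: h) lt' := by
  constructor
  · intro hst
    cases hst with
    | refl => exact absurd hv hs.reducible.not_isValue
    | trans h1 h2 =>
      obtain ⟨r, hr, rfl, rfl⟩ := (hs _ _ _).1 h1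
      exact ⟨r, _, hr, rfl, h2⟩
  · rintro ⟨r, lt', hr, rfl, hst⟩
    exact .trans (oev := some (opToEv o args r)) ((hs _ _ _).2 ⟨r, hr, rfl, rfl⟩) hst

theorem Sim.steps_iff_beh {e : Exp} {m : Io Bool} (he : Sim TypeRep.bool.Rel e m) (b : Bool) :
    ∀ (h : History) (lt : Trace), Steps e (if b then .tru else .fls) h lt ↔ m.Beh h lt b := by
  have hb : Exp.IsValue (if b then .tru else .fls) := TypeRep.Rel.isValue .bool (x := b) rfl
  induction he with
  | @ret v x hv =>
    intro h lt
    constructor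
    · intro hs
      obtain ⟨rfl, hbv⟩ := hs.eq_of_isValue (TypeRep.Rel.isValue .bool hv)
      refine ⟨rfl, ?_⟩
      cases hv
      cases b <;> cases x <;> simp at hbv ⊢
    · rintro ⟨rfl, rfl⟩
      cases hv
      exact .refl _ _
  | silent hs _ ih => intro h lt; rw [hs.steps_iff hb, ih]
  | call hs _ ih => intro h lt; simp only [hs.steps_iff hb, Io.Beh, ih]

theorem sim_linkT {I : Interface} (P : ProgS I) (C : CtxT I) :
    Sim TypeRep.bool.Rel (linkT (compile P) C).1 (linkS P (backTranslate C)) := by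
  have hP := sim_compileVal P.2 (s := Exp.var) (g := ()) trivial
  have hC := sim_backExp C.2 (s := Exp.var) (g := ()) trivial
  rw [Exp.subst_var] at hP hC
  exact hP.appIo hC

theorem semT_linkT_iff {I : Interface} (P : ProgS I) (C : CtxT I) (t : Behavior) :
    SemT (linkT (compile P) C) t ↔ SemS (linkS P (backTranslate C)) t := by
  rw [SemS, fsBeh_iff, ← (sim_linkT P C).steps_iff_beh, SemT, EBeh, and_iff_left]
  intro e' oev hs
  exact hs.not_isValue (TypeRep.Rel.isValue .bool (x := t.2) rfl)

end SEIO

/-- Robust relational hyperproperty preservation: every typed target context has a source context,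
namely its back-translation, that behaves in the same way with all source programs. -/
theorem mainTheorem1 (I : SEIO.Interface) (CT : SEIO.CtxT I) :
    ∃ CS : SEIO.CtxS I, CS = SEIO.backTranslate CT ∧
      ∀ (P : SEIO.ProgS I) (t : SEIO.Behavior),
        SEIO.SemT (SEIO.linkT (SEIO.compile P) CT) t ↔ SEIO.SemS (SEIO.linkS P CS) t :=
  ⟨_, rfl, fun P t => SEIO.semT_linkT_iff P CT t⟩
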